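/- Let $\mathbb{F}$ be a field of prime characteristic $p$, let $L$ be a finite-dimensional Lie algebra over $\mathbb{F}$, and let $M$ be a finite-dimensional $L$-module with corresponding representation $\rho\colon L\to\mathfrak{gl}(M)$. Let $(\mathfrak{L},(\cdot)^{[p]},\iota)$ be a $p$-envelope of $L$, i.e. $\mathfrak{L}$ is a restricted Lie algebra over $\mathbb{F}$ with $p$-mapping $(\cdot)^{[p]}$ and $\iota\colon L\to\mathfrak{L}$ is an injective Lie algebra homomorphism such that $\mathfrak{L}$ is generated by $\iota(L)$ as a restricted Lie algebra; assume that $\dim_{\mathbb{F}}\mathfrak{L}/\iota(L)<\infty$. Let $\hat{L}$ be the universal $p$-envelope of $L$, i.e. the smallest Lie subalgebra of the universal enveloping algebra $U(L)$ that contains the image of $L$ and is closed under $u\mapsto u^p$, let $\hat{\iota}\colon L\to\hat{L}$ be the canonical homomorphism, and let $\hat{\rho}\colon\hat{L}\to\mathfrak{gl}(M)$ be the restricted representation with $\hat{\rho}\circ\hat{\iota}=\rho$ (the restriction to $\hat{L}$ of the algebra homomorphism $U(L)\to\mathrm{End}_{\mathbb{F}}(M)$ induced by $\rho$). Let $\phi\colon\mathfrak{L}\to\hat{L}$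 be any Lie algebra homomorphism with $\phi\circ\iota=\hat{\iota}$, and regard $M$ as an $\mathfrak{L}$-module via $\hat{\rho}\circ\phi$. Let $H^j$ denote ordinary (Chevalley–Eilenberg) Lie algebra cohomology. Then, for every integer $n\ge 0$, one has $H^j(L,M)=0$ for all $0\le j\le n$ if and only if $H^j(\mathfrak{L},M)=0$ for all $0\le j\le n$. In particular, $H^\bullet(L,M)=0$ if and only if $H^\bullet(\mathfrak{L},M)=0$, that is, $H^j(L,M)=0$ for all $j\ge 0$ if and only if $H^j(\mathfrak{L},M)=0$ for all $j\ge 0$. -/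

import Mathlib

open scoped TensorProduct Polynomial

attribute [local instance 100] LieRing.ofAssociativeRing

namespace LieCohomology

variable {R L M : Type*} [CommRing R] [LieRing L] [LieAlgebra R L] [AddCommGroup M] [Module R M]

theorem sum_update_update {n : ℕ} (x : L) (f : L [⋀^Fin n]→ₗ[R] M) (w : Fin n → L) (i : Fin n)
    (c : L) :
    ∑ k, f (Function.update (Function.update w i c) k ⁅x, Function.update w i c k⁆) =
      f (Function.update w i ⁅x, c⁆) +
        ∑ k ∈ Finset.univ.erase i, f (Function.update (Function.update w k ⁅x, w k⁆) i c) := by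
  rw [← Finset.add_sum_erase _ _ (Finset.mem_univ i)]
  congr 1
  · simp
  · refine Finset.sum_congr rfl fun k hk => ?_
    have hk := Finset.ne_of_mem_erase hk
    rw [Function.update_comm hk.symm, Function.update_of_ne hk]

/-- The natural action of `x : L` on `n`-cochains:
`(θ_x f)(w) = ρ(x) f(w) - ∑ k, f(w_0, …, [x, w_k], …, w_{n-1})`. -/
def theta (ρ : L →ₗ⁅R⁆ Module.End R M) {n : ℕ} (x : L) (f : L [⋀^Fin n]→ₗ[R] M) :
    L [⋀^Fin n]→ₗ[R] M where
  toFun w := ρ x (f w) - ∑ k, f (Function.update w k ⁅x, w k⁆)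
  map_update_add' {inst} w i a b := by
    obtain rfl : inst = instDecidableEqFin n := Subsingleton.elim _ _
    simp only [sum_update_update, lie_add, AlternatingMap.map_update_add, map_add,
      Finset.sum_add_distrib]
    abel
  map_update_smul' {inst} w i r a := by
    obtain rfl : inst = instDecidableEqFin n := Subsingleton.elim _ _
    simp only [sum_update_update, lie_smul, AlternatingMap.map_update_smul, map_smul,
      ← Finset.smul_sum, ← smul_add, ← smul_sub]
  map_eq_zero_of_eq' w i j hij hne := by
    have h0 : f w = 0 := f.map_eq_zero_of_eq w hij hne
    rw [h0, map_zero, zero_sub, neg_eq_zero]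
    rw [Fintype.sum_eq_add i j hne]
    · have : Function.update w j ⁅x, w j⁆ = Function.update w i ⁅x, w i⁆ ∘ Equiv.swap i j := by
        funext k
        simp only [Function.comp]
        by_cases hi : k = i
        · subst hi
          simp [Function.update_of_ne hne, Function.update_of_ne hne.symm, hij]
        · by_cases hj : k = j
          · subst hj
            simp [hij]
          · rw [Equiv.swap_apply_of_ne_of_ne hi hj, Function.update_of_ne hi,
              Function.update_of_ne hj]
      rw [this, f.map_swap _ hne, add_neg_cancel]
    · rintro k ⟨hki, hkj⟩
      apply f.map_eq_zero_of_eq _ _ hne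
      rw [Function.update_of_ne hki.symm, Function.update_of_ne hkj.symm, hij]

/-- The value of the Chevalley–Eilenberg differential of an `n`-cochain `f` at `(v_0, …, v_n)`:
`∑ i, (-1)^i ρ(v_i) f(…, v̂_i, …) - ∑ i < j, (-1)^i f(…, v̂_i, …, [v_i, v_j], …)`, where in the
second sum `v_i` is omitted and `[v_i, v_j]` stands in the place of `v_j` (in the code `v_j` is the
entry with index `k = j - 1` of the tuple without `v_i`). See `differential_apply_succ` for the
form in which the bracket is moved to the front. -/
def differentialFun (ρ : L →ₗ⁅R⁆ Module.End R M) {n : ℕ} (f : L [⋀^Fin n]→ₗ[R] M)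
    (v : Fin (n + 1) → L) : M :=
  ∑ i : Fin (n + 1), (-1 : ℤ) ^ (i : ℕ) •
    (ρ (v i) (f (i.removeNth v)) -
      ∑ k : Fin n with i ≤ k.castSucc,
        f (Function.update (i.removeNth v) k ⁅v i, i.removeNth v k⁆))

theorem differentialFun_succ (ρ : L →ₗ⁅R⁆ Module.End R M) {n : ℕ} (f : L [⋀^Fin (n + 1)]→ₗ[R] M)
    (v : Fin (n + 2) → L) :
    differentialFun ρ f v = theta ρ (v 0) f (Fin.tail v) -
      differentialFun ρ (f.curryLeft (v 0)) (Fin.tail v) := by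
  obtain ⟨x, w, rfl⟩ : ∃ x w, v = Fin.cons x w := ⟨v 0, Fin.tail v, (Fin.cons_self_tail v).symm⟩
  unfold differentialFun
  rw [Fin.sum_univ_succ, sub_eq_add_neg (theta ρ _ f _), ← Finset.sum_neg_distrib]
  congr 1
  · simp [theta, Fin.removeNth_zero]
  · refine Finset.sum_congr rfl fun i _ => ?_
    have hr : (i.succ.removeNth (Fin.cons x w : Fin (n + 2) → L)) =
        (Fin.cons x (i.removeNth w) : Fin (n + 1) → L) := by
      funext k
      refine Fin.cases ?_ (fun k => ?_) k <;> simp [Fin.removeNth]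
    simp only [hr, Fin.cons_succ, Fin.cons_zero, Fin.tail_cons, Fin.val_succ, pow_succ, mul_neg,
      mul_one, neg_smul]
    congr 3
    simp only [Finset.sum_filter]
    rw [Fin.sum_univ_succ]
    simp [Matrix.vecCons, Fin.cons_update, Fin.le_def]

theorem differentialFun_add (ρ : L →ₗ⁅R⁆ Module.End R M) {n : ℕ} (f g : L [⋀^Fin n]→ₗ[R] M)
    (v : Fin (n + 1) → L) :
    differentialFun ρ (f + g) v = differentialFun ρ f v + differentialFun ρ g v := by
  rw [differentialFun, differentialFun, differentialFun, ← Finset.sum_add_distrib]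
  refine Finset.sum_congr rfl fun i _ => ?_
  simp only [AlternatingMap.add_apply, map_add, Finset.sum_add_distrib, ← smul_add,
    add_sub_add_comm]

theorem differentialFun_smul (ρ : L →ₗ⁅R⁆ Module.End R M) {n : ℕ} (r : R)
    (f : L [⋀^Fin n]→ₗ[R] M) (v : Fin (n + 1) → L) :
    differentialFun ρ (r • f) v = r • differentialFun ρ f v := by
  simp only [differentialFun, AlternatingMap.smul_apply, map_smul, Finset.smul_sum,
    smul_sub, smul_comm r]

theorem theta_add (ρ : L →ₗ⁅R⁆ Module.End R M) {n : ℕ} (f : L [⋀^Fin n]→ₗ[R] M) (x y : L) :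
    theta ρ (x + y) f = theta ρ x f + theta ρ y f := by
  ext w
  simp [theta, Finset.sum_add_distrib, add_sub_add_comm]

theorem theta_smul (ρ : L →ₗ⁅R⁆ Module.End R M) {n : ℕ} (f : L [⋀^Fin n]→ₗ[R] M) (r : R) (x : L) :
    theta ρ (r • x) f = r • theta ρ x f := by
  ext w
  simp [theta, Finset.smul_sum, smul_sub]

theorem curryLeft_theta (ρ : L →ₗ⁅R⁆ Module.End R M) {n : ℕ} (f : L [⋀^Fin (n + 1)]→ₗ[R] M)
    (x y : L) :
    (theta ρ x f).curryLeft y = theta ρ x (f.curryLeft y) - f.curryLeft ⁅x, y⁆ := by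
  ext w
  have h0 : Function.update (Fin.cons y w : Fin (n + 1) → L) 0 ⁅x, y⁆ = Fin.cons ⁅x, y⁆ w :=
    Fin.update_cons_zero _ _ _
  simp only [theta, Matrix.vecCons, AlternatingMap.curryLeft_apply_apply, AlternatingMap.coe_mk,
    MultilinearMap.coe_mk, AlternatingMap.sub_apply, Fin.sum_univ_succ, Fin.cons_zero,
    Fin.cons_succ, Fin.cons_update, h0]
  abel

/-- A linear family of alternating maps `g x` with `g x (x, …) = 0` is an alternating map. -/
theorem exists_uncurry {n : ℕ} (g : L →ₗ[R] L [⋀^Fin n]→ₗ[R] M)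
    (hg : ∀ x w k, k.val = 0 → w k = x → g x w = 0) :
    ∃ h : L [⋀^Fin (n + 1)]→ₗ[R] M, ∀ v, h v = g (v 0) (Fin.tail v) := by
  have hg' : ∀ x w k, w k = x → g x w = 0 := by
    intro x w k hk
    obtain ⟨m, rfl⟩ : ∃ m, m + 1 = n := by simp [k.pos]
    by_cases h0 : k = 0
    · exact hg x w k (by simp [h0]) hk
    · have := (g x).map_swap w h0
      rw [hg x _ 0 rfl (by simpa using hk)] at this
      exact (neg_eq_zero.mp this.symm)
  refine ⟨{ (LinearMap.uncurryLeft (AlternatingMap.toMultilinearMapLM (S := R) ∘ₗ g) :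
    MultilinearMap R (fun _ : Fin (n + 1) => L) M) with map_eq_zero_of_eq' := ?_ }, fun v => rfl⟩
  intro v i j hij hne
  change g (v 0) (Fin.tail v) = 0
  revert hij hne
  refine Fin.cases ?_ (fun i => ?_) i <;> refine Fin.cases ?_ (fun j => ?_) j
  · intro _ h; exact absurd rfl h
  · intro h _; exact hg' _ _ j h.symm
  · intro h _; exact hg' _ _ i h
  · intro h hne; exact (g (v 0)).map_eq_zero_of_eq _ h (fun h => hne (by rw [h]))

theorem exists_differential (ρ : L →ₗ⁅R⁆ Module.End R M) :
    ∀ {n : ℕ} (f : L [⋀^Fin n]→ₗ[R] M),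
      ∃ g : L [⋀^Fin (n + 1)]→ₗ[R] M, ∀ v, g v = differentialFun ρ f v
  | 0, f => by
    obtain ⟨h, hh⟩ := exists_uncurry
      (g := { toFun := fun x => theta ρ x f, map_add' := theta_add ρ f, map_smul' := theta_smul ρ f })
      (fun x w k => k.elim0)
    refine ⟨h, fun v => ?_⟩
    rw [hh]
    simp [differentialFun, theta, Fin.removeNth_zero]
  | n + 1, f => by
    choose G hG using fun x => exists_differential ρ (f.curryLeft x)
    obtain ⟨h, hh⟩ := exists_uncurry
      (g := { toFun := fun x => theta ρ x f - G x
              map_add' := fun x y => by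
                ext v
                simp [theta_add, hG, differentialFun_add]
                abel
              map_smul' := fun r x => by
                ext v
                simp [theta_smul, hG, differentialFun_smul, smul_sub] }) <| by
        intro x w k hk hw
        obtain rfl : k = 0 := Fin.ext hk
        simp only [LinearMap.coe_mk, AddHom.coe_mk, AlternatingMap.sub_apply, hG]
        have hx : theta ρ x f w = theta ρ x (f.curryLeft x) (Fin.tail w) := by
          have := congrArg (fun h => h (Fin.tail w)) (curryLeft_theta ρ f x x)
          simp only [lie_self, map_zero, sub_zero] at this
          rw [← this, AlternatingMap.curryLeft_apply_apply, ← hw]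
          exact congrArg _ (Fin.cons_self_tail w).symm
        rw [hx]
        cases n with
        | zero => 
          simp [differentialFun, theta, Fin.removeNth_zero, hw]
        | succ n =>
          rw [differentialFun_succ, hw]
          simp [differentialFun]
    refine ⟨h, fun v => ?_⟩
    rw [hh, differentialFun_succ]
    simp [hG]

/-- The Chevalley–Eilenberg differential. -/
def differential (ρ : L →ₗ⁅R⁆ Module.End R M) (n : ℕ) :
    (L [⋀^Fin n]→ₗ[R] M) →ₗ[R] (L [⋀^Fin (n + 1)]→ₗ[R] M) where
  toFun f :=
    { toFun := differentialFun ρ f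
      map_update_add' := fun {inst} v i x y => by
        obtain ⟨g, hg⟩ := exists_differential ρ f
        simp only [← hg, g.map_update_add]
      map_update_smul' := fun {inst} v i r x => by
        obtain ⟨g, hg⟩ := exists_differential ρ f
        simp only [← hg, g.map_update_smul]
      map_eq_zero_of_eq' := fun v i j hv hij => by
        obtain ⟨g, hg⟩ := exists_differential ρ f
        rw [← hg]
        exact g.map_eq_zero_of_eq v hv hij }
  map_add' f g := AlternatingMap.ext (differentialFun_add ρ f g)
  map_smul' r f := AlternatingMap.ext (differentialFun_smul ρ r f)

/-- The usual formula
`(d f)(v_0, …, v_{n+1}) = ∑ i, (-1)^i ρ(v_i) f(…, v̂_i, …)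
  + ∑ i < j, (-1)^(i+j) f([v_i, v_j], …, v̂_i, …, v̂_j, …)`, where `j = k + 1` with `i ≤ k`. -/
theorem differential_apply_succ (ρ : L →ₗ⁅R⁆ Module.End R M) {n : ℕ}
    (f : L [⋀^Fin (n + 1)]→ₗ[R] M) (v : Fin (n + 2) → L) :
    differential ρ (n + 1) f v =
      ∑ i : Fin (n + 2), (-1 : ℤ) ^ (i : ℕ) • ρ (v i) (f (i.removeNth v)) +
      ∑ i : Fin (n + 2), ∑ k : Fin (n + 1) with i ≤ k.castSucc,
        (-1 : ℤ) ^ ((i : ℕ) + (k.succ : ℕ)) •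
          f (Matrix.vecCons ⁅v i, v k.succ⁆ (k.removeNth (i.removeNth v))) := by
  change differentialFun ρ f v = _
  rw [differentialFun, ← Finset.sum_add_distrib]
  refine Finset.sum_congr rfl fun i _ => ?_
  rw [smul_sub, sub_eq_add_neg, Finset.smul_sum, ← Finset.sum_neg_distrib]
  congr 1
  refine Finset.sum_congr rfl fun k hk => ?_
  have hk : i ≤ k.castSucc := by simpa using hk
  have h : i.removeNth v k = v k.succ := by
    simp [Fin.removeNth_apply, Fin.succAbove_of_le_castSucc, hk]
  rw [h, ← Fin.insertNth_removeNth k _ (i.removeNth v), AlternatingMap.map_insertNth, smul_smul, Fin.val_succ,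
    ← add_assoc, pow_succ, pow_add]
  simp

theorem curryLeft_differential_zero (ρ : L →ₗ⁅R⁆ Module.End R M) (f : L [⋀^Fin 0]→ₗ[R] M)
    (x : L) : (differential ρ 0 f).curryLeft x = theta ρ x f := by
  ext w
  change differentialFun ρ f (Matrix.vecCons x w) = _
  simp [differentialFun, theta, Subsingleton.elim _ w]

/-- Cartan's formula. -/
theorem curryLeft_differential_succ (ρ : L →ₗ⁅R⁆ Module.End R M) {n : ℕ}
    (f : L [⋀^Fin (n + 1)]→ₗ[R] M) (x : L) :
    (differential ρ (n + 1) f).curryLeft x = theta ρ x f - differential ρ n (f.curryLeft x) := by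
  ext w
  exact differentialFun_succ ρ f (Fin.cons x w)

theorem ext_curryLeft {n : ℕ} {f g : L [⋀^Fin (n + 1)]→ₗ[R] M}
    (h : ∀ x, f.curryLeft x = g.curryLeft x) : f = g := by
  ext v
  have := congrArg (fun a => a (Fin.tail v)) (h (v 0))
  simpa [Matrix.vecCons] using this

theorem theta_sub (ρ : L →ₗ⁅R⁆ Module.End R M) {n : ℕ} (f g : L [⋀^Fin n]→ₗ[R] M) (x : L) :
    theta ρ x (f - g) = theta ρ x f - theta ρ x g := by
  ext w
  simp only [theta, AlternatingMap.coe_mk, MultilinearMap.coe_mk, AlternatingMap.sub_apply,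
    map_sub, Finset.sum_sub_distrib]
  abel

theorem theta_lie (ρ : L →ₗ⁅R⁆ Module.End R M) (x y : L) :
    ∀ {n : ℕ} (f : L [⋀^Fin n]→ₗ[R] M),
      theta ρ ⁅x, y⁆ f = theta ρ x (theta ρ y f) - theta ρ y (theta ρ x f)
  | 0, f => by
    ext w
    simp [theta, LieRing.of_associative_ring_bracket]
  | n + 1, f => by
    refine ext_curryLeft fun z => ?_
    have h : ∀ a b : L [⋀^Fin (n + 1)]→ₗ[R] M,
      (a - b).curryLeft z = a.curryLeft z - b.curryLeft z := fun a b => rfl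
    simp only [h, curryLeft_theta, theta_sub, theta_lie ρ x y (f.curryLeft z), lie_lie, map_sub]
    abel

theorem theta_differential (ρ : L →ₗ⁅R⁆ Module.End R M) (x : L) :
    ∀ {n : ℕ} (f : L [⋀^Fin n]→ₗ[R] M),
      theta ρ x (differential ρ n f) = differential ρ n (theta ρ x f)
  | 0, f => by
    refine ext_curryLeft fun y => ?_
    rw [curryLeft_theta, curryLeft_differential_zero, curryLeft_differential_zero,
      curryLeft_differential_zero, theta_lie]
    abel
  | n + 1, f => by
    refine ext_curryLeft fun y => ?_
    rw [curryLeft_theta, curryLeft_differential_succ, curryLeft_differential_succ,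
      curryLeft_differential_succ, theta_lie, theta_sub, theta_differential ρ x (f.curryLeft y),
      curryLeft_theta, map_sub]
    abel

/-- The Chevalley–Eilenberg cochains form a complex. -/
theorem differential_differential (ρ : L →ₗ⁅R⁆ Module.End R M) :
    ∀ {n : ℕ} (f : L [⋀^Fin n]→ₗ[R] M), differential ρ (n + 1) (differential ρ n f) = 0
  | 0, f => by
    refine ext_curryLeft fun y => ?_
    rw [curryLeft_differential_succ, curryLeft_differential_zero, theta_differential, sub_self]
    rfl
  | n + 1, f => by
    refine ext_curryLeft fun y => ?_
    rw [curryLeft_differential_succ, curryLeft_differential_succ, theta_differential, map_sub,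
      differential_differential ρ (f.curryLeft y)]
    simp

/-- The `n`-coboundaries: zero for `n = 0`, the range of the preceding differential otherwise. -/
def coboundaries (ρ : L →ₗ⁅R⁆ Module.End R M) : (n : ℕ) → Submodule R (L [⋀^Fin n]→ₗ[R] M)
  | 0 => ⊥
  | n + 1 => LinearMap.range (differential ρ n)

/-- The `n`-cocycles. -/
def cocycles (ρ : L →ₗ⁅R⁆ Module.End R M) (n : ℕ) : Submodule R (L [⋀^Fin n]→ₗ[R] M) :=
  LinearMap.ker (differential ρ n)

/-- The ordinary (Chevalley–Eilenberg) cohomology `H^n(L, M)` of the Lie algebra `L` with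
coefficients in the `L`-module `M` given by the representation `ρ`: `n`-cocycles modulo
`n`-coboundaries. -/
abbrev H (ρ : L →ₗ⁅R⁆ Module.End R M) (n : ℕ) : Type _ :=
  cocycles ρ n ⧸ (coboundaries ρ n).submoduleOf (cocycles ρ n)

end LieCohomology

namespace RestrictedLie

section

variable (F : Type*) [Field F] (p : ℕ) {L : Type*} [LieRing L] [LieAlgebra F L]

/-- The Lie polynomials `s_i(a, b)`, determined for `1 ≤ i ≤ p - 1` by
`(ad (a ⊗ X + b ⊗ 1))^(p-1) (a ⊗ 1) = ∑ i, i s_i(a, b) ⊗ X^(i-1)` in `L ⊗ F[X]`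
(the code writes the polynomial factor on the left). -/
noncomputable def jacobsonS (i : ℕ) (a b : L) : L :=
  (i : F)⁻¹ • TensorProduct.lid F L ((Polynomial.lcoeff F (i - 1)).rTensor L
    (((LieAlgebra.ad F[X] (F[X] ⊗[F] L) ((Polynomial.X : F[X]) ⊗ₜ[F] a + (1 : F[X]) ⊗ₜ[F] b)) ^ (p - 1))
      ((1 : F[X]) ⊗ₜ[F] a)))

/-- `P` is a `p`-mapping on the Lie algebra `L`, i.e. `(L, P)` is a restricted Lie algebra. -/
structure IsPMapping (P : L → L) : Prop where
  ad_map : ∀ a, LieAlgebra.ad F L (P a) = (LieAlgebra.ad F L a) ^ p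
  map_smul : ∀ (c : F) a, P (c • a) = c ^ p • P a
  map_add : ∀ a b, P (a + b) = P a + P b + ∑ i ∈ Finset.Icc 1 (p - 1), jacobsonS F p i a b

/-- The smallest Lie subalgebra that contains `S` and is closed under `P`. -/
def pClosure (P : L → L) (S : Set L) : LieSubalgebra F L :=
  sInf {H | S ⊆ H ∧ ∀ x ∈ H, P x ∈ H}

theorem mem_pClosure (P : L → L) (S : Set L) (x : L) :
    x ∈ pClosure F P S ↔
      ∀ H : LieSubalgebra F L, S ⊆ H → (∀ y ∈ H, P y ∈ H) → x ∈ H := by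
  rw [pClosure, ← SetLike.mem_coe, LieSubalgebra.coe_sInf]
  simp

/-- `(E, P, ι)` is a `p`-envelope of `L`: `P` is a `p`-mapping on `E`, the homomorphism `ι : L → E`
is injective and `E` is generated by `ι(L)` as a restricted Lie algebra. -/
structure IsPEnvelope {E : Type*} [LieRing E] [LieAlgebra F E] (P : E → E) (ι : L →ₗ⁅F⁆ E) :
    Prop where
  isPMapping : IsPMapping F p P
  injective : Function.Injective ι
  pClosure_eq_top : pClosure F P (Set.range ι) = ⊤

end

section

variable (F : Type*) [Field F] (p : ℕ) (L : Type*) [LieRing L] [LieAlgebra F L]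

/-- The universal `p`-envelope `L̂` of `L`: the restricted Lie subalgebra generated by the image of
`L` in the universal enveloping algebra, with the associative `p`-th power as `p`-mapping. -/
def universalPEnvelope : LieSubalgebra F (UniversalEnvelopingAlgebra F L) :=
  pClosure F (fun u => u ^ p) (Set.range (UniversalEnvelopingAlgebra.ι F : L → _))

/-- The canonical homomorphism `L → L̂`. -/
def universalPEnvelope.ι : L →ₗ⁅F⁆ universalPEnvelope F p L where
  toFun x := ⟨UniversalEnvelopingAlgebra.ι F x, by
    rw [universalPEnvelope, mem_pClosure]
    exact fun H hH _ => hH ⟨x, rfl⟩⟩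
  map_add' x y := Subtype.ext (map_add (UniversalEnvelopingAlgebra.ι F) x y)
  map_smul' c x := Subtype.ext (map_smul (UniversalEnvelopingAlgebra.ι F) c x)
  map_lie' {x y} := Subtype.ext (LieHom.map_lie (UniversalEnvelopingAlgebra.ι F) x y)

variable {L} {M : Type*} [AddCommGroup M] [Module F M]

/-- The unique extension of a representation `ρ` of `L` on `M` to a restricted representation of
`L̂` on `M` (restricted: it takes `p`-th powers to `p`-th powers): the restriction to `L̂` of the
algebra homomorphism on the universal enveloping algebra induced by `ρ`. -/
noncomputable def universalPEnvelope.lift (ρ : L →ₗ⁅F⁆ Module.End F M) :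
    universalPEnvelope F p L →ₗ⁅F⁆ Module.End F M :=
  (AlgHom.toLieHom (UniversalEnvelopingAlgebra.lift F ρ)).comp (universalPEnvelope F p L).incl

theorem universalPEnvelope.lift_comp_ι (ρ : L →ₗ⁅F⁆ Module.End F M) :
    (universalPEnvelope.lift F p ρ).comp (universalPEnvelope.ι F p L) = ρ :=
  LieHom.ext fun x => UniversalEnvelopingAlgebra.lift_ι_apply F ρ x

theorem universalPEnvelope.pow_mem (u : universalPEnvelope F p L) :
    (u : UniversalEnvelopingAlgebra F L) ^ p ∈ universalPEnvelope F p L := by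
  have hu := (mem_pClosure F _ _ _).mp u.2
  exact (mem_pClosure F _ _ _).mpr fun H hS hP => hP _ (hu H hS hP)

theorem universalPEnvelope.lift_pow (ρ : L →ₗ⁅F⁆ Module.End F M) (u : universalPEnvelope F p L) :
    universalPEnvelope.lift F p ρ ⟨_, universalPEnvelope.pow_mem F p u⟩ =
      universalPEnvelope.lift F p ρ u ^ p :=
  map_pow (UniversalEnvelopingAlgebra.lift F ρ) _ p

end

end RestrictedLie

/-! Write `E` for the `p`-envelope and `τ` for the representation `ρ̂ ∘ φ`. Since `ad (P a) = (ad
a)^p`, brackets of `E` lie in `ι(L)`. Hence every subspace between `ι(L)` and `E` is an ideal, and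
`E`, being finite-dimensional, is reached from `ι(L)` by adjoining one vector at a time.

For ideals `N ⊂ N' = N + F e` containing `ι(L)` there is an exact sequence `H^(k-1)(N) → H^k(N') →
H^k(N) → H^k(N)`, whose last map is the action `Θ` of `e`. Vanishing up to degree `n` therefore
passes from `N` to `N'`. Conversely, if `H^k(N') = 0` then `Θ` is injective on `H^k(N)`, so `H^k(N)
= 0` once `Θ` is nilpotent there (`IsComplementVector.cocycles_le_coboundaries`,
`IsComplementVector.cocycles_comp_le_coboundaries`).

Nilpotency is the point where characteristic `p` enters. The map `φ` need not respect `p`-th powers,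
so `(τ e, ad e)` cannot be handled by generation directly. Instead consider pairs `(u, e)` with `u`
in `U(L)` for which `(ρ(u), ad e)` acts by zero on `H(N)` and `[u, φ y] = φ [e, y]`. They contain
all `(x, ι x)` and are closed under linear combinations, brackets and `p`-th powers
(`cochainAct_pow_prime`). So each `e` has a partner `u` in `L̂`, and `φ e - u` has a partner `e'` in
`E`. Then `(τ e, ad (e + e'))` acts by zero, while `φ [e', y] = 0` forces `[e', y]` to be central,
so `(ad e')^2 = 0`. Thus `Θ` agrees on cohomology with the action of `(0, -ad e')`, whose `p`-th
power is zero (`IsPEnvelope.exists_pow_mem_coboundaries`). -/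

namespace LieCohomology

/-! ### Endomorphism pairs acting on alternating maps -/

section CochainAct

variable {R L M : Type*} [CommRing R] [AddCommGroup L] [Module R L] [AddCommGroup M] [Module R M]

theorem sum_update_update_linear {n : ℕ} (D : Module.End R L) (f : L [⋀^Fin n]→ₗ[R] M)
    (w : Fin n → L) (i : Fin n) (c : L) :
    ∑ k, f (Function.update (Function.update w i c) k (D (Function.update w i c k))) =
      f (Function.update w i (D c)) +
        ∑ k ∈ Finset.univ.erase i, f (Function.update (Function.update w k (D (w k))) i c) := by
  rw [← Finset.add_sum_erase _ _ (Finset.mem_univ i)]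
  congr 1
  · simp
  · refine Finset.sum_congr rfl fun k hk => ?_
    have hk := Finset.ne_of_mem_erase hk
    rw [Function.update_comm hk.symm, Function.update_of_ne hk]

/-- The action of a pair of endomorphisms `A` of `M` and `D` of `L` on alternating maps:
`f ↦ A ∘ f - ∑ k, f(w_0, …, D w_k, …, w_{n-1})`. -/
def cochainAct (A : Module.End R M) (D : Module.End R L) (n : ℕ) :
    Module.End R (L [⋀^Fin n]→ₗ[R] M) where
  toFun f :=
    { toFun := fun w => A (f w) - ∑ k, f (Function.update w k (D (w k)))
      map_update_add' := fun {inst} w i a b => by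
        obtain rfl : inst = instDecidableEqFin n := Subsingleton.elim _ _
        simp only [sum_update_update_linear, AlternatingMap.map_update_add, map_add,
          Finset.sum_add_distrib]
        abel
      map_update_smul' := fun {inst} w i r a => by
        obtain rfl : inst = instDecidableEqFin n := Subsingleton.elim _ _
        simp only [sum_update_update_linear, AlternatingMap.map_update_smul, map_smul,
          ← Finset.smul_sum, ← smul_add, ← smul_sub]
      map_eq_zero_of_eq' := fun w i j hij hne => by
        have h0 : f w = 0 := f.map_eq_zero_of_eq w hij hne
        rw [h0, map_zero, zero_sub, neg_eq_zero]
        rw [Fintype.sum_eq_add i j hne]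
        · have : Function.update w j (D (w j)) =
              Function.update w i (D (w i)) ∘ Equiv.swap i j := by
            funext k
            simp only [Function.comp]
            by_cases hi : k = i
            · subst hi
              simp [Function.update_of_ne hne, Function.update_of_ne hne.symm, hij]
            · by_cases hj : k = j
              · subst hj
                simp [hij]
              · rw [Equiv.swap_apply_of_ne_of_ne hi hj, Function.update_of_ne hi,
                  Function.update_of_ne hj]
          rw [this, f.map_swap _ hne, add_neg_cancel]
        · rintro k ⟨hki, hkj⟩
          apply f.map_eq_zero_of_eq _ _ hne
          rw [Function.update_of_ne hki.symm, Function.update_of_ne hkj.symm, hij] }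
  map_add' f g := by
    ext w
    simp [Finset.sum_add_distrib, add_sub_add_comm]
  map_smul' r f := by
    ext w
    simp [Finset.smul_sum, smul_sub]

theorem cochainAct_apply (A : Module.End R M) (D : Module.End R L) {n : ℕ}
    (f : L [⋀^Fin n]→ₗ[R] M) (w : Fin n → L) :
    cochainAct A D n f w = A (f w) - ∑ k, f (Function.update w k (D (w k))) := rfl

theorem cochainAct_zero_apply (A : Module.End R M) (D : Module.End R L)
    (f : L [⋀^Fin 0]→ₗ[R] M) (w : Fin 0 → L) : cochainAct A D 0 f w = A (f w) := by
  simp [cochainAct_apply]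

/-- Contraction lowers the degree by one, so this identity drives the inductions on degree below. -/
theorem curryLeft_cochainAct (A : Module.End R M) (D : Module.End R L) {n : ℕ}
    (f : L [⋀^Fin (n + 1)]→ₗ[R] M) (y : L) :
    (cochainAct A D (n + 1) f).curryLeft y =
      cochainAct A D n (f.curryLeft y) - f.curryLeft (D y) := by
  ext w
  have h0 : Function.update (Fin.cons y w : Fin (n + 1) → L) 0 (D y) = Fin.cons (D y) w :=
    Fin.update_cons_zero _ _ _
  simp only [cochainAct_apply, Matrix.vecCons, AlternatingMap.curryLeft_apply_apply,
    AlternatingMap.sub_apply, Fin.sum_univ_succ, Fin.cons_zero,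
    Fin.cons_succ, Fin.cons_update, h0]
  abel

theorem cochainAct_add (A B : Module.End R M) (D D' : Module.End R L) (n : ℕ) :
    cochainAct (A + B) (D + D') n = cochainAct A D n + cochainAct B D' n := by
  ext f w
  simp [cochainAct_apply, Finset.sum_add_distrib, add_sub_add_comm]

theorem cochainAct_smul (c : R) (A : Module.End R M) (D : Module.End R L) (n : ℕ) :
    cochainAct (c • A) (c • D) n = c • cochainAct A D n := by
  ext f w
  simp [cochainAct_apply, Finset.smul_sum, smul_sub]

theorem cochainAct_zero (n : ℕ) :
    cochainAct (0 : Module.End R M) (0 : Module.End R L) n = 0 := by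
  simpa using cochainAct_smul (0 : R) (0 : Module.End R M) (0 : Module.End R L) n

theorem eq_of_curryLeft_eq {n : ℕ} {f g : L [⋀^Fin (n + 1)]→ₗ[R] M}
    (h : ∀ x, f.curryLeft x = g.curryLeft x) : f = g := by
  ext v
  have := congrArg (fun a => a (Fin.tail v)) (h (v 0))
  simpa [Matrix.vecCons] using this

theorem cochainAct_lie (A B : Module.End R M) (D D' : Module.End R L) :
    ∀ {n : ℕ} (f : L [⋀^Fin n]→ₗ[R] M), cochainAct ⁅A, B⁆ ⁅D, D'⁆ n f =
      cochainAct A D n (cochainAct B D' n f) - cochainAct B D' n (cochainAct A D n f)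
  | 0, f => by
    ext w
    simp [cochainAct_zero_apply, LieRing.of_associative_ring_bracket]
  | n + 1, f => by
    refine eq_of_curryLeft_eq fun z => ?_
    have h : ∀ a b : L [⋀^Fin (n + 1)]→ₗ[R] M,
      (a - b).curryLeft z = a.curryLeft z - b.curryLeft z := fun a b => rfl
    simp only [h, curryLeft_cochainAct]
    rw [cochainAct_lie A B D D' (f.curryLeft z)]
    simp only [map_sub, LieRing.of_associative_ring_bracket, LinearMap.sub_apply,
      Module.End.mul_apply]
    abel

end CochainAct

/-! ### Frobenius identities in characteristic `p` -/

theorem _root_.Commute.sub_pow_prime_of_algebra (F : Type*) {A : Type*} [Field F] [Ring A]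
    [Algebra F A] (p : ℕ) [Fact p.Prime] [CharP F p] {a b : A} (h : Commute a b) :
    (a - b) ^ p = a ^ p - b ^ p := by
  rcases subsingleton_or_nontrivial A with _ | _
  · exact Subsingleton.elim _ _
  · have := charP_of_injective_algebraMap (algebraMap F A).injective p
    exact sub_pow_char_of_commute _ h

/-- `ad a` is the difference of left and right multiplication by `a`, which commute. -/
theorem _root_.LieAlgebra.ad_pow_prime (F : Type*) {A : Type*} [Field F] [Ring A]
    [Algebra F A] (p : ℕ) [Fact p.Prime] [CharP F p] (a : A) :
    LieAlgebra.ad F A (a ^ p) = LieAlgebra.ad F A a ^ p := by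
  have h : ∀ a : A, LieAlgebra.ad F A a = LinearMap.mulLeft F a - LinearMap.mulRight F a :=
    fun a => by ext; rfl
  rw [h, h, Commute.sub_pow_prime_of_algebra F p (LinearMap.commute_mulLeft_right (R := F) a a),
    LinearMap.pow_mulLeft, LinearMap.pow_mulRight]

section Field

variable {F L M : Type*} [Field F] (p : ℕ) [Fact p.Prime] [CharP F p]

/-- Currying turns the action in degree `n + 1` into `a - b` on linear maps from `L` to
`n`-cochains, where `a` is composition with the action in degree `n` and `b` is precomposition with
`D`. These commute, so `(a - b)^p = a^p - b^p`, and induction on the degree applies. -/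
theorem cochainAct_pow_prime [AddCommGroup L] [Module F L] [AddCommGroup M] [Module F M]
    (A : Module.End F M) (D : Module.End F L) :
    ∀ n : ℕ, cochainAct (A ^ p) (D ^ p) n = cochainAct A D n ^ p
  | 0 => by
    have h : ∀ k : ℕ, ∀ f w, (cochainAct A D 0 ^ k) f w = (A ^ k) (f w) := by
      intro k
      induction k with
      | zero => simp
      | succ k ih =>
        intro f w
        rw [pow_succ', Module.End.mul_apply, cochainAct_zero_apply, ih, pow_succ',
          Module.End.mul_apply]
    ext f w
    rw [h, cochainAct_zero_apply]
  | n + 1 => by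
    let c : (L [⋀^Fin (n + 1)]→ₗ[F] M) →ₗ[F] (L →ₗ[F] L [⋀^Fin n]→ₗ[F] M) :=
      AlternatingMap.curryLeftLinearMap
    let a : Module.End F (L →ₗ[F] L [⋀^Fin n]→ₗ[F] M) := LinearMap.compRight F (cochainAct A D n)
    let b : Module.End F (L →ₗ[F] L [⋀^Fin n]→ₗ[F] M) := LinearMap.lcomp F _ D
    have hab : Commute a b := by
      ext g x w
      rfl
    have hc : ∀ f, c (cochainAct A D (n + 1) f) = (a - b) (c f) := fun f =>
      LinearMap.ext fun y => curryLeft_cochainAct A D f y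
    have hk : ∀ (k : ℕ) f, c ((cochainAct A D (n + 1) ^ k) f) = ((a - b) ^ k) (c f) := by
      intro k
      induction k with
      | zero => simp
      | succ k ih =>
        intro f
        rw [pow_succ', Module.End.mul_apply, hc, ih, pow_succ', Module.End.mul_apply]
    have ha : ∀ (k : ℕ) (g : L →ₗ[F] L [⋀^Fin n]→ₗ[F] M) y, (a ^ k) g y = (cochainAct A D n ^ k) (g y) := by
      intro k
      induction k with
      | zero => simp
      | succ k ih =>
        intro g y
        rw [pow_succ', Module.End.mul_apply, pow_succ', Module.End.mul_apply, ← ih]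
        rfl
    have hb : ∀ (k : ℕ) (g : L →ₗ[F] L [⋀^Fin n]→ₗ[F] M) y, (b ^ k) g y = g ((D ^ k) y) := by
      intro k
      induction k with
      | zero => simp
      | succ k ih =>
        intro g y
        rw [pow_succ, Module.End.mul_apply, ih, pow_succ', Module.End.mul_apply]
        rfl
    refine LinearMap.ext fun f => eq_of_curryLeft_eq fun y => ?_
    have h := LinearMap.congr_fun (hk p f) y
    have hs : (a - b) ^ p = a ^ p - b ^ p :=
      Commute.sub_pow_prime_of_algebra (A := Module.End F (L →ₗ[F] L [⋀^Fin n]→ₗ[F] M)) F p hab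
    rw [hs, LinearMap.sub_apply, LinearMap.sub_apply, ha, hb] at h
    rw [curryLeft_cochainAct, cochainAct_pow_prime A D n]
    exact h.symm

end Field

/-! ### Pairs acting by zero on cohomology -/

section Compatible

variable {R L M : Type*} [CommRing R] [LieRing L] [LieAlgebra R L] [AddCommGroup M] [Module R M]

/-- The pair `(A, D)` is compatible with the representation `ρ`: `D` is a derivation of `L` and
`[A, ρ(x)] = ρ(D x)`. -/
structure IsCompatible (ρ : L →ₗ⁅R⁆ Module.End R M) (A : Module.End R M) (D : Module.End R L) :
    Prop where
  lie_apply : ∀ x, ⁅A, ρ x⁆ = ρ (D x)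
  lie_ad : ∀ x, ⁅D, LieAlgebra.ad R L x⁆ = LieAlgebra.ad R L (D x)

theorem theta_eq_cochainAct (ρ : L →ₗ⁅R⁆ Module.End R M) {n : ℕ} (x : L)
    (f : L [⋀^Fin n]→ₗ[R] M) : theta ρ x f = cochainAct (ρ x) (LieAlgebra.ad R L x) n f := rfl

variable {ρ : L →ₗ⁅R⁆ Module.End R M} {A : Module.End R M} {D : Module.End R L}

theorem IsCompatible.theta_apply (h : IsCompatible ρ A D) {n : ℕ} (x : L)
    (f : L [⋀^Fin n]→ₗ[R] M) :
    theta ρ (D x) f = cochainAct A D n (theta ρ x f) - theta ρ x (cochainAct A D n f) := by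
  simp only [theta_eq_cochainAct]
  rw [← h.lie_apply, ← h.lie_ad, cochainAct_lie]

/-- Contract with `y` and use Cartan's formula; the terms with `D y` cancel by compatibility, and
the rest is the claim one degree lower. -/
theorem IsCompatible.cochainAct_differential (h : IsCompatible ρ A D) :
    ∀ {n : ℕ} (f : L [⋀^Fin n]→ₗ[R] M),
      cochainAct A D (n + 1) (differential ρ n f) = differential ρ n (cochainAct A D n f)
  | 0, f => by
    refine ext_curryLeft fun y => ?_
    rw [curryLeft_cochainAct, curryLeft_differential_zero, curryLeft_differential_zero,
      curryLeft_differential_zero, h.theta_apply]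
    abel
  | n + 1, f => by
    refine ext_curryLeft fun y => ?_
    rw [curryLeft_cochainAct, curryLeft_differential_succ, curryLeft_differential_succ,
      curryLeft_differential_succ, h.theta_apply, map_sub,
      h.cochainAct_differential (f.curryLeft y), curryLeft_cochainAct, map_sub]
    abel

theorem IsCompatible.cochainAct_mem_cocycles (h : IsCompatible ρ A D) {n : ℕ}
    {f : L [⋀^Fin n]→ₗ[R] M} (hf : f ∈ cocycles ρ n) : cochainAct A D n f ∈ cocycles ρ n := by
  rw [cocycles, LinearMap.mem_ker] at hf ⊢
  rw [← h.cochainAct_differential, hf, map_zero]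

theorem IsCompatible.cochainAct_mem_coboundaries (h : IsCompatible ρ A D) :
    ∀ {n : ℕ} {f : L [⋀^Fin n]→ₗ[R] M}, f ∈ coboundaries ρ n →
      cochainAct A D n f ∈ coboundaries ρ n
  | 0, f, hf => by
    rw [(Submodule.mem_bot R).mp hf, map_zero]
    exact zero_mem _
  | n + 1, f, hf => by
    obtain ⟨g, rfl⟩ := hf
    exact ⟨cochainAct A D n g, (h.cochainAct_differential g).symm⟩

/-- The compatible pair `(A, D)` acts on the cohomology of `ρ` by zero. -/
structure ActsTrivially (ρ : L →ₗ⁅R⁆ Module.End R M) (A : Module.End R M) (D : Module.End R L) :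
    Prop extends IsCompatible ρ A D where
  mem_coboundaries : ∀ {n : ℕ} {f : L [⋀^Fin n]→ₗ[R] M}, f ∈ cocycles ρ n →
    cochainAct A D n f ∈ coboundaries ρ n

theorem ActsTrivially.zero : ActsTrivially ρ 0 0 where
  lie_apply x := by simp
  lie_ad x := by simp
  mem_coboundaries {n f} _ := by simp [cochainAct_zero]

theorem ActsTrivially.add {A B : Module.End R M} {D D' : Module.End R L}
    (h : ActsTrivially ρ A D) (h' : ActsTrivially ρ B D') : ActsTrivially ρ (A + B) (D + D') where
  lie_apply x := by rw [add_lie, h.lie_apply, h'.lie_apply, LinearMap.add_apply, map_add]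
  lie_ad x := by rw [add_lie, h.lie_ad, h'.lie_ad, LinearMap.add_apply, map_add]
  mem_coboundaries hf := by
    rw [cochainAct_add]
    exact add_mem (h.mem_coboundaries hf) (h'.mem_coboundaries hf)

theorem ActsTrivially.smul (h : ActsTrivially ρ A D) (c : R) :
    ActsTrivially ρ (c • A) (c • D) where
  lie_apply x := by rw [smul_lie, h.lie_apply, LinearMap.smul_apply, map_smul]
  lie_ad x := by rw [smul_lie, h.lie_ad, LinearMap.smul_apply, map_smul]
  mem_coboundaries hf := by
    rw [cochainAct_smul]
    exact Submodule.smul_mem _ _ (h.mem_coboundaries hf)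

theorem ActsTrivially.lie {A B : Module.End R M} {D D' : Module.End R L}
    (h : ActsTrivially ρ A D) (h' : ActsTrivially ρ B D') : ActsTrivially ρ ⁅A, B⁆ ⁅D, D'⁆ where
  lie_apply x := by
    rw [lie_lie, h'.lie_apply, h.lie_apply, h.lie_apply, h'.lie_apply, ← map_sub]
    rfl
  lie_ad x := by
    rw [lie_lie, h'.lie_ad, h.lie_ad, h.lie_ad, h'.lie_ad, ← map_sub]
    rfl
  mem_coboundaries {n f} hf := by
    rw [cochainAct_lie]
    exact sub_mem (h.cochainAct_mem_coboundaries (h'.mem_coboundaries hf))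
      (h'.cochainAct_mem_coboundaries (h.mem_coboundaries hf))

/-- By Cartan's formula, contraction with `x` is a homotopy from `theta ρ x` to zero. -/
theorem ActsTrivially.apply (ρ : L →ₗ⁅R⁆ Module.End R M) (x : L) :
    ActsTrivially ρ (ρ x) (LieAlgebra.ad R L x) where
  lie_apply y := (ρ.map_lie x y).symm
  lie_ad y := ((LieAlgebra.ad R L).map_lie x y).symm
  mem_coboundaries {n f} hf := by
    rw [cocycles, LinearMap.mem_ker] at hf
    rw [← theta_eq_cochainAct]
    cases n with
    | zero =>
      rw [← curryLeft_differential_zero, hf]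
      exact zero_mem _
    | succ n =>
      have h := curryLeft_differential_succ ρ f x
      rw [hf] at h
      exact ⟨f.curryLeft x, (sub_eq_zero.mp h.symm).symm⟩

theorem ActsTrivially.pow_prime {F L M : Type*} [Field F] (p : ℕ) [Fact p.Prime] [CharP F p]
    [LieRing L] [LieAlgebra F L] [AddCommGroup M] [Module F M] {ρ : L →ₗ⁅F⁆ Module.End F M}
    {A : Module.End F M} {D : Module.End F L} (h : ActsTrivially ρ A D) :
    ActsTrivially ρ (A ^ p) (D ^ p) where
  lie_apply x := by
    have hk : ∀ k : ℕ, (LieAlgebra.ad F (Module.End F M) A ^ k) (ρ x) = ρ ((D ^ k) x) := by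
      intro k
      induction k with
      | zero => rfl
      | succ k ih =>
        rw [pow_succ', pow_succ', Module.End.mul_apply, ih, Module.End.mul_apply, ← h.lie_apply]
        rfl
    rw [← hk, ← LieAlgebra.ad_pow_prime]
    rfl
  lie_ad x := by
    have hk : ∀ k : ℕ, (LieAlgebra.ad F (Module.End F L) D ^ k) (LieAlgebra.ad F L x) =
        LieAlgebra.ad F L ((D ^ k) x) := by
      intro k
      induction k with
      | zero => rfl
      | succ k ih =>
        rw [pow_succ', pow_succ', Module.End.mul_apply, ih, Module.End.mul_apply, ← h.lie_ad]
        rfl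
    rw [← hk, ← LieAlgebra.ad_pow_prime]
    rfl
  mem_coboundaries {n f} hf := by
    have hp := (Fact.out : p.Prime).pos
    have hk : ∀ k : ℕ, (cochainAct A D n ^ (k + 1)) f ∈ coboundaries ρ n := by
      intro k
      induction k with
      | zero => simpa using h.mem_coboundaries hf
      | succ k ih =>
        rw [pow_succ', Module.End.mul_apply]
        exact h.cochainAct_mem_coboundaries ih
    rw [cochainAct_pow_prime, ← Nat.sub_add_cancel hp]
    exact hk _

end Compatible

/-- If a compatible pair differs from one that acts trivially on cohomology by a nilpotent
derivation of `L`, then it acts nilpotently on cohomology. -/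
theorem IsCompatible.exists_pow_mem_coboundaries {F L M : Type*} [Field F] (p : ℕ) [Fact p.Prime]
    [CharP F p] [LieRing L] [LieAlgebra F L] [AddCommGroup M] [Module F M]
    {ρ : L →ₗ⁅F⁆ Module.End F M} {A : Module.End F M} {D D' : Module.End F L}
    (h : IsCompatible ρ A D) (h' : ActsTrivially ρ A (D + D')) (hD' : D' ^ p = 0) {n : ℕ}
    {f : L [⋀^Fin n]→ₗ[F] M} (hf : f ∈ cocycles ρ n) :
    (cochainAct A D n ^ p) f ∈ coboundaries ρ n := by
  -- The difference of the compatible pairs `(A, D)` and `(A, D + D')`.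
  have hT : IsCompatible ρ 0 (-D') := by
    constructor <;> intro x
    · have h1 := h'.lie_apply x
      rw [h.lie_apply, LinearMap.add_apply, map_add, left_eq_add] at h1
      simp [h1]
    · have h1 := h'.lie_ad x
      rw [add_lie, h.lie_ad, LinearMap.add_apply, map_add, add_right_inj] at h1
      simp [h1]
  have hsum : cochainAct A D n = cochainAct A (D + D') n + cochainAct 0 (-D') n := by
    rw [← cochainAct_add]
    simp
  have hpow : cochainAct (0 : Module.End F M) (-D') n ^ p = 0 := by
    rw [← cochainAct_pow_prime, neg_pow, hD', mul_zero, zero_pow (Fact.out : p.Prime).ne_zero,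
      cochainAct_zero]
  -- On cocycles, the actions of `(A, D)` and `(0, -D')` agree modulo coboundaries, hence so do
  -- their powers; the `p`-th power of the second is zero.
  have hk : ∀ k : ℕ, (cochainAct 0 (-D') n ^ k) f ∈ cocycles ρ n ∧
      (cochainAct A D n ^ k) f - (cochainAct 0 (-D') n ^ k) f ∈ coboundaries ρ n := by
    intro k
    induction k with
    | zero => simpa using hf
    | succ k ih =>
      simp only [pow_succ', Module.End.mul_apply]
      refine ⟨hT.cochainAct_mem_cocycles ih.1, ?_⟩
      have h1 := add_mem (h.cochainAct_mem_coboundaries ih.2) (h'.mem_coboundaries ih.1)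
      have h2 := LinearMap.congr_fun hsum ((cochainAct 0 (-D') n ^ k) f)
      rw [LinearMap.add_apply] at h2
      rw [map_sub, h2] at h1
      convert h1 using 1
      abel
  have := (hk p).2
  rwa [hpow, LinearMap.zero_apply, sub_zero] at this

end LieCohomology

namespace LieCohomology

/-! ### Restriction of cochains along a homomorphism -/

section Restriction

variable {R I G M : Type*} [CommRing R] [AddCommGroup M] [Module R M]

/-- Pulling back alternating maps along a linear map. -/
def pullback [AddCommGroup I] [Module R I] [AddCommGroup G] [Module R G] (M : Type*)
    [AddCommGroup M] [Module R M] (j : I →ₗ[R] G) (n : ℕ) :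
    (G [⋀^Fin n]→ₗ[R] M) →ₗ[R] (I [⋀^Fin n]→ₗ[R] M) where
  toFun f := f.compLinearMap j
  map_add' _ _ := rfl
  map_smul' _ _ := rfl

section Linear

variable [AddCommGroup I] [Module R I] [AddCommGroup G] [Module R G] (j : I →ₗ[R] G)

theorem pullback_apply {n : ℕ} (f : G [⋀^Fin n]→ₗ[R] M) (w : Fin n → I) :
    pullback M j n f w = f (fun i => j (w i)) := rfl

theorem curryLeft_pullback {n : ℕ} (f : G [⋀^Fin (n + 1)]→ₗ[R] M) (y : I) :
    (pullback M j (n + 1) f).curryLeft y = pullback M j n (f.curryLeft (j y)) :=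
  AlternatingMap.curryLeft_compLinearMap j f y

theorem pullback_cochainAct {A : Module.End R M} {D : Module.End R I} {D' : Module.End R G}
    (h : ∀ x, j (D x) = D' (j x)) :
    ∀ {n : ℕ} (f : G [⋀^Fin n]→ₗ[R] M),
      pullback M j n (cochainAct A D' n f) = cochainAct A D n (pullback M j n f)
  | 0, f => by
    ext w
    simp only [pullback_apply, cochainAct_zero_apply]
  | n + 1, f => by
    refine eq_of_curryLeft_eq fun y => ?_
    rw [curryLeft_pullback, curryLeft_cochainAct, curryLeft_cochainAct, curryLeft_pullback,
      curryLeft_pullback, map_sub, pullback_cochainAct h, h]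

end Linear

theorem pullback_differential [LieRing I] [LieAlgebra R I] [LieRing G] [LieAlgebra R G]
    (j : I →ₗ⁅R⁆ G) (ρ : G →ₗ⁅R⁆ Module.End R M) :
    ∀ {n : ℕ} (f : G [⋀^Fin n]→ₗ[R] M), pullback M (j : I →ₗ[R] G) (n + 1) (differential ρ n f) =
      differential (ρ.comp j) n (pullback M (j : I →ₗ[R] G) n f)
  | 0, f => by
    refine eq_of_curryLeft_eq fun y => ?_
    rw [curryLeft_pullback, curryLeft_differential_zero, curryLeft_differential_zero,
      theta_eq_cochainAct, theta_eq_cochainAct]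
    exact pullback_cochainAct _ (fun x => j.map_lie y x) f
  | n + 1, f => by
    refine eq_of_curryLeft_eq fun y => ?_
    rw [curryLeft_pullback, curryLeft_differential_succ, curryLeft_differential_succ,
      theta_eq_cochainAct, theta_eq_cochainAct, map_sub, curryLeft_pullback,
      pullback_differential j ρ]
    congr 1
    exact pullback_cochainAct _ (fun x => j.map_lie y x) f

end Restriction

theorem subsingleton_H_iff {R L M : Type*} [CommRing R] [LieRing L] [LieAlgebra R L]
    [AddCommGroup M] [Module R M] (ρ : L →ₗ⁅R⁆ Module.End R M) (n : ℕ) :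
    Subsingleton (H ρ n) ↔ cocycles ρ n ≤ coboundaries ρ n := by
  rw [Submodule.Quotient.subsingleton_iff, Submodule.submoduleOf,
    Submodule.comap_subtype_eq_top]

/-! ### Transport of vanishing along an isomorphism -/

section Equiv

variable {R L L' M : Type*} [CommRing R] [LieRing L] [LieAlgebra R L] [LieRing L']
  [LieAlgebra R L'] [AddCommGroup M] [Module R M]

theorem cocycles_le_coboundaries_of_equiv (σ : L ≃ₗ⁅R⁆ L') (ρ : L' →ₗ⁅R⁆ Module.End R M) {n : ℕ}
    (h : cocycles ρ n ≤ coboundaries ρ n) :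
    cocycles (ρ.comp (σ : L →ₗ⁅R⁆ L')) n ≤ coboundaries (ρ.comp (σ : L →ₗ⁅R⁆ L')) n := by
  intro f hf
  set g := pullback M ((σ.symm : L' →ₗ⁅R⁆ L) : L' →ₗ[R] L) n f with hg
  have hfg : f = pullback M ((σ : L →ₗ⁅R⁆ L') : L →ₗ[R] L') n g := by
    ext w
    simp [hg, pullback_apply]
  have hρ : (ρ.comp (σ : L →ₗ⁅R⁆ L')).comp (σ.symm : L' →ₗ⁅R⁆ L) = ρ := by
    ext x
    simp
  have hgc : g ∈ cocycles ρ n := by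
    have h1 := pullback_differential (σ.symm : L' →ₗ⁅R⁆ L) (ρ.comp (σ : L →ₗ⁅R⁆ L')) f
    rw [cocycles, LinearMap.mem_ker] at hf ⊢
    rwa [hf, map_zero, hρ, eq_comm] at h1
  have hgb := h hgc
  cases n with
  | zero =>
    rw [hfg, (Submodule.mem_bot R).mp hgb, map_zero]
    exact zero_mem _
  | succ n =>
    obtain ⟨k, hk⟩ := hgb
    rw [hfg, ← hk, pullback_differential]
    exact ⟨_, rfl⟩

theorem subsingleton_H_iff_of_equiv (σ : L ≃ₗ⁅R⁆ L') {ρ : L →ₗ⁅R⁆ Module.End R M}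
    {ρ' : L' →ₗ⁅R⁆ Module.End R M} (h : ∀ x, ρ' (σ x) = ρ x) (n : ℕ) :
    Subsingleton (H ρ n) ↔ Subsingleton (H ρ' n) := by
  have h1 : ρ = ρ'.comp (σ : L →ₗ⁅R⁆ L') := LieHom.ext fun x => (h x).symm
  have h2 : ρ' = ρ.comp (σ.symm : L' →ₗ⁅R⁆ L) := LieHom.ext fun x => by
    rw [LieHom.comp_apply, ← h]
    simp
  rw [subsingleton_H_iff, subsingleton_H_iff]
  constructor
  · intro hc
    rw [h2]
    exact cocycles_le_coboundaries_of_equiv σ.symm ρ hc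
  · intro hc
    rw [h1]
    exact cocycles_le_coboundaries_of_equiv σ ρ' hc

end Equiv

/-! ### Cohomology of an ideal of codimension one -/

section Hyperplane

variable {R I G M : Type*} [CommRing R] [AddCommGroup M] [Module R M]

section Linear

variable [AddCommGroup I] [Module R I] [AddCommGroup G] [Module R G]

/-- The vector `e` spans a complement of the image of the split injection `j`. -/
structure IsComplementVector (j : I →ₗ[R] G) (π : G →ₗ[R] I) (l : G →ₗ[R] R) (e : G) : Prop where
  proj_apply : ∀ x, π (j x) = x
  coord_apply : ∀ x, l (j x) = 0
  coord_vector : l e = 1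
  decomp : ∀ g, g = j (π g) + l g • e

variable {j : I →ₗ[R] G} {π : G →ₗ[R] I} {l : G →ₗ[R] R} {e : G}

theorem pullback_zero_injective {f : G [⋀^Fin 0]→ₗ[R] M} (hf : pullback M j 0 f = 0) : f = 0 := by
  ext w
  have := congrArg (fun a => a (fun i => i.elim0)) hf
  simp only [pullback_apply] at this
  rw [Subsingleton.elim w _]
  exact this

/-- A cochain on `G` is determined by its values on `I` and by the values on `I` of its contraction
with `e`, since `e` can occur at most once among the arguments. In the induction, `f.curryLeft e`
vanishes because contracting twice with `e` gives zero. -/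
theorem IsComplementVector.eq_zero_of_pullback_zero (h : IsComplementVector j π l e) :
    ∀ {n : ℕ} {f : G [⋀^Fin (n + 1)]→ₗ[R] M}, pullback M j (n + 1) f = 0 →
      pullback M j n (f.curryLeft e) = 0 → f = 0 := by
  have hself : ∀ {n : ℕ} (f : G [⋀^Fin (n + 2)]→ₗ[R] M) (x : G),
      (f.curryLeft x).curryLeft x = 0 := fun f x => f.curryLeft_same x
  have hswap : ∀ {n : ℕ} (f : G [⋀^Fin (n + 2)]→ₗ[R] M) (x y : G),
      (f.curryLeft x).curryLeft y = -(f.curryLeft y).curryLeft x := by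
    intro n f x y
    have h1 := hself f (x + y)
    have h2 : ∀ a b : G [⋀^Fin (n + 1)]→ₗ[R] M, (a + b).curryLeft = a.curryLeft + b.curryLeft :=
      fun a b => rfl
    rw [map_add, map_add, h2, LinearMap.add_apply, LinearMap.add_apply, hself, hself, zero_add,
      add_zero] at h1
    exact (neg_eq_of_add_eq_zero_right h1).symm
  intro n
  induction n with
  | zero =>
    intro f h0 h1
    refine eq_of_curryLeft_eq fun x => ?_
    have h2 := pullback_zero_injective h1
    have h3 : f.curryLeft (j (π x)) = 0 :=
      pullback_zero_injective (j := j) (by rw [← curryLeft_pullback, h0]; rfl)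
    rw [h.decomp x, map_add, map_smul, h2, h3, smul_zero, add_zero]
    rfl
  | succ n ih =>
    intro f h0 h1
    have h2 : f.curryLeft e = 0 := ih h1 (by rw [hself, map_zero])
    refine eq_of_curryLeft_eq fun x => ?_
    have h3 : f.curryLeft (j (π x)) = 0 := ih (by rw [← curryLeft_pullback, h0]; rfl)
      (by rw [hswap, h2]; simp)
    rw [h.decomp x, map_add, map_smul, h2, h3, smul_zero, add_zero]
    rfl

/-- The witness is `π^* a + l ∧ π^* b`; contraction with `e` kills the first term because `π e = 0`.
-/
theorem IsComplementVector.exists_pullback (h : IsComplementVector j π l e) {n : ℕ}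
    (a : I [⋀^Fin (n + 1)]→ₗ[R] M) (b : I [⋀^Fin n]→ₗ[R] M) :
    ∃ f : G [⋀^Fin (n + 1)]→ₗ[R] M, pullback M j (n + 1) f = a ∧
      pullback M j n (f.curryLeft e) = b := by
  have hπe : π e = 0 := by
    have h1 := h.decomp e
    rw [h.coord_vector, one_smul, right_eq_add] at h1
    rw [← h.proj_apply (π e), h1, map_zero]
  let k : G →ₗ[R] G [⋀^Fin n]→ₗ[R] M := l.smulRight (pullback M π n b)
  refine ⟨pullback M π (n + 1) a + AlternatingMap.alternatizeUncurryFin k, ?_, ?_⟩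
  · ext w
    simp only [pullback_apply, AlternatingMap.add_apply, h.proj_apply,
      AlternatingMap.alternatizeUncurryFin_apply, k, LinearMap.smulRight_apply, h.coord_apply,
      zero_smul, AlternatingMap.zero_apply, smul_zero, Finset.sum_const_zero, add_zero]
  · ext w
    simp only [pullback_apply, AlternatingMap.curryLeft_apply_apply, AlternatingMap.add_apply,
      AlternatingMap.alternatizeUncurryFin_apply, k, LinearMap.smulRight_apply,
      Fin.sum_univ_succ, h.coord_apply,
      zero_smul, AlternatingMap.zero_apply, smul_zero, Finset.sum_const_zero, add_zero,
      h.coord_vector, one_smul, Fin.val_zero, pow_zero, Fin.removeNth_zero, Matrix.vecCons,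
      Fin.tail_cons, h.proj_apply, Fin.cons_zero, Fin.cons_succ]
    rw [a.map_coord_zero 0 (by simp [hπe]), zero_add]

end Linear

variable [LieRing I] [LieAlgebra R I] [LieRing G] [LieAlgebra R G]
  {j : I →ₗ⁅R⁆ G} {π : G →ₗ[R] I} {l : G →ₗ[R] R} {e : G} {D : Module.End R I}

theorem pullback_curryLeft_differential_zero (ρ : G →ₗ⁅R⁆ Module.End R M)
    (hD : ∀ x, j (D x) = ⁅e, j x⁆) (f : G [⋀^Fin 0]→ₗ[R] M) :
    pullback M (j : I →ₗ[R] G) 0 ((differential ρ 0 f).curryLeft e) =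
      cochainAct (ρ e) D 0 (pullback M (j : I →ₗ[R] G) 0 f) := by
  rw [curryLeft_differential_zero, theta_eq_cochainAct]
  exact pullback_cochainAct _ hD f

/-- In terms of the pair (restriction, restricted contraction), the differential on `G` sends `(a,
b)` to `(d a, Θ a - d b)`: `G`-cochains form the mapping cone of `Θ`, up to shift and sign. -/
theorem pullback_curryLeft_differential_succ (ρ : G →ₗ⁅R⁆ Module.End R M)
    (hD : ∀ x, j (D x) = ⁅e, j x⁆) {n : ℕ} (f : G [⋀^Fin (n + 1)]→ₗ[R] M) :
    pullback M (j : I →ₗ[R] G) (n + 1) ((differential ρ (n + 1) f).curryLeft e) =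
      cochainAct (ρ e) D (n + 1) (pullback M (j : I →ₗ[R] G) (n + 1) f) -
        differential (ρ.comp j) n (pullback M (j : I →ₗ[R] G) n (f.curryLeft e)) := by
  rw [curryLeft_differential_succ, theta_eq_cochainAct, map_sub, pullback_differential]
  congr 1
  exact pullback_cochainAct _ hD f

theorem exists_pullback_zero (a : I [⋀^Fin 0]→ₗ[R] M) :
    ∃ f : G [⋀^Fin 0]→ₗ[R] M, pullback M (j : I →ₗ[R] G) 0 f = a :=
  ⟨pullback M 0 0 a, by ext w; simp only [pullback_apply]; congr 1; exact Subsingleton.elim _ _⟩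

/-- Vanishing of the cohomology up to degree `n` passes from an ideal of codimension one to the
whole Lie algebra. -/
theorem IsComplementVector.cocycles_le_coboundaries
    (h : IsComplementVector (j : I →ₗ[R] G) π l e) (ρ : G →ₗ⁅R⁆ Module.End R M)
    (hD : ∀ x, j (D x) = ⁅e, j x⁆) (hc : IsCompatible (ρ.comp j) (ρ e) D) {n : ℕ}
    (hI : ∀ k ≤ n, cocycles (ρ.comp j) k ≤ coboundaries (ρ.comp j) k) :
    cocycles ρ n ≤ coboundaries ρ n := by
  intro f hf
  rw [cocycles, LinearMap.mem_ker] at hf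
  have hr : pullback M (j : I →ₗ[R] G) n f ∈ coboundaries (ρ.comp j) n := by
    refine hI n le_rfl ?_
    rw [cocycles, LinearMap.mem_ker, ← pullback_differential, hf, map_zero]
  cases n with
  | zero =>
    rw [pullback_zero_injective ((Submodule.mem_bot R).mp hr)]
    exact zero_mem _
  | succ q =>
    obtain ⟨g, hg⟩ := hr
    have hs := pullback_curryLeft_differential_succ ρ hD f
    rw [hf, ← hg, hc.cochainAct_differential, ← map_sub] at hs
    -- With `f` restricting to `d g`, the equation `hs` says that `Θ g` minus the restricted
    -- contraction of `f` is a cocycle, hence a coboundary `d b` (zero in degree `0`).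
    have hcb := hI q (Nat.le_succ q) (show _ ∈ cocycles (ρ.comp j) q from hs.symm)
    have key : ∃ u, pullback M (j : I →ₗ[R] G) q u = g ∧
        pullback M (j : I →ₗ[R] G) q ((differential ρ q u).curryLeft e) =
          pullback M (j : I →ₗ[R] G) q (f.curryLeft e) := by
      cases q with
      | zero =>
        obtain ⟨u, hu⟩ := exists_pullback_zero (j := j) g
        refine ⟨u, hu, ?_⟩
        rw [pullback_curryLeft_differential_zero ρ hD, hu]
        exact sub_eq_zero.mp ((Submodule.mem_bot R).mp hcb)
      | succ q =>
        obtain ⟨b, hb⟩ := hcb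
        -- The cochain with components `(g, b)` has differential with components `(d g, Θ g - d b)`,
        -- which are those of `f`.
        obtain ⟨u, hu, hu'⟩ := h.exists_pullback g b
        refine ⟨u, hu, ?_⟩
        rw [pullback_curryLeft_differential_succ ρ hD, hu, hu', hb, sub_sub_cancel]
    obtain ⟨u, hu, hu'⟩ := key
    refine ⟨u, sub_eq_zero.mp (h.eq_zero_of_pullback_zero ?_ ?_)⟩
    · rw [map_sub, pullback_differential, hu, hg, sub_self]
    · have h2 : ∀ a b : G [⋀^Fin (q + 1)]→ₗ[R] M,
        (a - b).curryLeft e = a.curryLeft e - b.curryLeft e := fun a b => rfl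
      rw [h2, map_sub, hu', sub_self]

/-- If a complement of an ideal of codimension one acts nilpotently on the cohomology of the ideal,
then vanishing of the cohomology passes from the whole Lie algebra to the ideal. -/
theorem IsComplementVector.cocycles_comp_le_coboundaries
    (h : IsComplementVector (j : I →ₗ[R] G) π l e) (ρ : G →ₗ⁅R⁆ Module.End R M)
    (hD : ∀ x, j (D x) = ⁅e, j x⁆) (hc : IsCompatible (ρ.comp j) (ρ e) D) {n : ℕ}
    (hnil : ∀ f ∈ cocycles (ρ.comp j) n, ∃ k : ℕ,
      (cochainAct (ρ e) D n ^ k) f ∈ coboundaries (ρ.comp j) n)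
    (hG : cocycles ρ n ≤ coboundaries ρ n) :
    cocycles (ρ.comp j) n ≤ coboundaries (ρ.comp j) n := by
  -- Injectivity of `Θ` on the cohomology of `I`: if `Θ f = d b`, then `(f, b)` extends `f` to a
  -- cocycle on `G`, hence to a coboundary, which restricts to a coboundary.
  have key : ∀ f ∈ cocycles (ρ.comp j) n, cochainAct (ρ e) D n f ∈ coboundaries (ρ.comp j) n →
      f ∈ coboundaries (ρ.comp j) n := by
    intro f hf hΘ
    rw [cocycles, LinearMap.mem_ker] at hf
    cases n with
    | zero =>
      obtain ⟨u, hu⟩ := exists_pullback_zero (j := j) f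
      have hu0 : u ∈ cocycles ρ 0 := by
        rw [cocycles, LinearMap.mem_ker]
        refine h.eq_zero_of_pullback_zero ?_ ?_
        · rw [pullback_differential, hu, hf]
        · rw [pullback_curryLeft_differential_zero ρ hD, hu]
          exact (Submodule.mem_bot R).mp hΘ
      rw [← hu, (Submodule.mem_bot R).mp (hG hu0), map_zero]
      exact zero_mem _
    | succ q =>
      obtain ⟨b, hb⟩ := hΘ
      obtain ⟨u, hu, hu'⟩ := h.exists_pullback f b
      have hu0 : u ∈ cocycles ρ (q + 1) := by
        rw [cocycles, LinearMap.mem_ker]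
        refine h.eq_zero_of_pullback_zero ?_ ?_
        · rw [pullback_differential, hu, hf]
        · rw [pullback_curryLeft_differential_succ ρ hD, hu, hu', hb, sub_self]
      obtain ⟨g, hg⟩ := hG hu0
      rw [← hu, ← hg, pullback_differential]
      exact ⟨_, rfl⟩
  have hk : ∀ (k : ℕ) (f), f ∈ cocycles (ρ.comp j) n →
      (cochainAct (ρ e) D n ^ k) f ∈ coboundaries (ρ.comp j) n →
        f ∈ coboundaries (ρ.comp j) n := by
    intro k
    induction k with
    | zero => exact fun f _ hf => hf
    | succ k ih =>
      intro f hf hf'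
      rw [pow_succ, Module.End.mul_apply] at hf'
      exact key f hf (ih _ (hc.cochainAct_mem_cocycles hf) hf')
  intro f hf
  obtain ⟨k, hk'⟩ := hnil f hf
  exact hk k f hf hk'

end Hyperplane

end LieCohomology

namespace RestrictedLie

open LieCohomology

/-! ### Brackets and central elements in a `p`-envelope -/

section Envelope

variable {F : Type*} [Field F] {p : ℕ} {L E : Type*} [LieRing L] [LieAlgebra F L] [LieRing E]
  [LieAlgebra F E] {P : E → E} {ι : L →ₗ⁅F⁆ E}

theorem IsPEnvelope.mem_of_forall (hE : IsPEnvelope F p P ι) (H : LieSubalgebra F E)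
    (hι : ∀ x, ι x ∈ H) (hP : ∀ a ∈ H, P a ∈ H) (a : E) : a ∈ H := by
  have ha : a ∈ pClosure F P (Set.range ι) := by
    rw [hE.pClosure_eq_top]
    trivial
  exact (mem_pClosure F _ _ _).mp ha H (by rintro _ ⟨x, rfl⟩; exact hι x) hP

theorem IsPMapping.lie_map (hP : IsPMapping F p P) (a b : E) :
    ⁅P a, b⁆ = (LieAlgebra.ad F E a ^ p) b := by
  rw [← hP.ad_map, LieAlgebra.ad_apply]

/-- The normalizer of `ι(L)` contains `ι(L)` and is closed under `P`, as `ad (P a)` is a power of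
`ad a`. -/
theorem IsPEnvelope.lie_apply_mem_range (hE : IsPEnvelope F p P ι) (a : E) (x : L) :
    ⁅a, ι x⁆ ∈ ι.range := by
  have h := hE.mem_of_forall ι.range.normalizer
    (fun y => LieSubalgebra.le_normalizer _ ⟨y, rfl⟩) ?_ a
  · exact (LieSubalgebra.mem_normalizer_iff _ _).mp h _ ⟨x, rfl⟩
  · intro a ha
    rw [LieSubalgebra.mem_normalizer_iff] at ha ⊢
    intro y hy
    rw [hE.isPMapping.lie_map]
    have hk : ∀ k : ℕ, (LieAlgebra.ad F E a ^ k) y ∈ ι.range := by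
      intro k
      induction k with
      | zero => exact hy
      | succ k ih =>
        rw [pow_succ', Module.End.mul_apply]
        exact ha _ ih
    exact hk p

variable [Fact p.Prime]

/-- The derived algebra of a `p`-envelope of `L` is contained in the image of `L`. -/
theorem IsPEnvelope.lie_mem_range (hE : IsPEnvelope F p P ι) (a b : E) : ⁅a, b⁆ ∈ ι.range := by
  -- The elements `a` with `[a, E] ⊆ ι(L)`; closure under `P` holds because the last of the `p`
  -- applications of `ad a` already lands in `ι(L)`.
  let H : LieSubalgebra F E :=
    { carrier := {a | ∀ b, ⁅a, b⁆ ∈ ι.range}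
      zero_mem' := fun b => by simp
      add_mem' := fun {a a'} ha ha' b => by
        rw [add_lie]
        exact add_mem (ha b) (ha' b)
      smul_mem' := fun c a ha b => by
        rw [smul_lie]
        exact ι.range.smul_mem c (ha b)
      lie_mem' := fun {a a'} ha ha' b => by
        rw [lie_lie]
        exact sub_mem (ha _) (ha' _) }
  refine hE.mem_of_forall H (fun x b => ?_) (fun a ha b => ?_) a b
  · rw [← lie_skew]
    exact neg_mem (hE.lie_apply_mem_range b x)
  · rw [hE.isPMapping.lie_map, ← Nat.sub_add_cancel (Fact.out : p.Prime).pos, pow_succ',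
      Module.End.mul_apply]
    exact ha _

/-- The centralizer of `ι x` contains `ι(L)` and is closed under `P`. -/
theorem IsPEnvelope.lie_apply_eq_zero (hE : IsPEnvelope F p P ι) {x : L}
    (hx : ∀ y : L, ⁅y, x⁆ = 0)
    (a : E) : ⁅a, ι x⁆ = 0 := by
  let H : LieSubalgebra F E :=
    { carrier := {a | ⁅a, ι x⁆ = 0}
      zero_mem' := by simp
      add_mem' := fun {a a'} (ha : _ = 0) (ha' : _ = 0) => by simp [ha, ha']
      smul_mem' := fun c a (ha : _ = 0) => by simp [ha]
      lie_mem' := fun {a a'} (ha : _ = 0) (ha' : _ = 0) => by simp [ha, ha'] }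
  refine hE.mem_of_forall H (fun y => ?_) (fun a (ha : _ = 0) => ?_) a
  · change ⁅ι y, ι x⁆ = 0
    rw [← LieHom.map_lie, hx, map_zero]
  · change ⁅P a, ι x⁆ = 0
    rw [hE.isPMapping.lie_map, ← Nat.sub_add_cancel (Fact.out : p.Prime).pos, pow_succ,
      Module.End.mul_apply, LieAlgebra.ad_apply, ha, map_zero]

/-- The adjoint representation factors through `U(L)`, so whatever dies there is central;
injectivity of `L → U(L)` is not needed. -/
theorem lie_eq_zero_of_ι_eq_zero {x : L} (hx : UniversalEnvelopingAlgebra.ι F x = 0) (y : L) :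
    ⁅y, x⁆ = 0 := by
  have h := UniversalEnvelopingAlgebra.lift_ι_apply F (LieAlgebra.ad F L) x
  rw [hx, map_zero] at h
  rw [← lie_skew, ← LieAlgebra.ad_apply (R := F), ← h]
  simp

end Envelope

/-! ### Matching the envelope with `L̂`, and nilpotency -/

section Matched

variable {F : Type*} [Field F] {p : ℕ} {L E M : Type*} [LieRing L]
  [LieAlgebra F L] [LieRing E] [LieAlgebra F E] {P : E → E} {ι : L →ₗ⁅F⁆ E} [AddCommGroup M]
  [Module F M]

/-- The element `u` of the universal enveloping algebra acts on the image of `φ` as `e` acts on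
`E`, and the pair `(u, e)` acts by zero on the cohomology of the ideal `N` of `E`. -/
structure IsMatched (ρ : L →ₗ⁅F⁆ Module.End F M) (φ : E →ₗ⁅F⁆ universalPEnvelope F p L)
    (N : LieIdeal F E) (u : UniversalEnvelopingAlgebra F L) (e : E) : Prop where
  lie_apply : ∀ y, ⁅u, (φ y : UniversalEnvelopingAlgebra F L)⁆ = φ ⁅e, y⁆
  actsTrivially : ActsTrivially (((universalPEnvelope.lift F p ρ).comp φ).comp N.incl)
    (UniversalEnvelopingAlgebra.lift F ρ u) (LieModule.toEnd F E N e)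

variable {ρ : L →ₗ⁅F⁆ Module.End F M} {φ : E →ₗ⁅F⁆ universalPEnvelope F p L}
  {N : LieIdeal F E} {u v : UniversalEnvelopingAlgebra F L} {e e' : E}

theorem IsMatched.zero : IsMatched ρ φ N 0 0 where
  lie_apply y := by simp
  actsTrivially := by
    rw [map_zero, map_zero]
    exact ActsTrivially.zero

theorem IsMatched.add (h : IsMatched ρ φ N u e) (h' : IsMatched ρ φ N v e') :
    IsMatched ρ φ N (u + v) (e + e') where
  lie_apply y := by rw [add_lie, add_lie, map_add, h.lie_apply, h'.lie_apply]; rfl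
  actsTrivially := by
    rw [map_add, map_add]
    exact h.actsTrivially.add h'.actsTrivially

theorem IsMatched.smul (h : IsMatched ρ φ N u e) (c : F) : IsMatched ρ φ N (c • u) (c • e) where
  lie_apply y := by rw [smul_lie, smul_lie, map_smul, h.lie_apply]; rfl
  actsTrivially := by
    rw [map_smul, map_smul]
    exact h.actsTrivially.smul c

theorem IsMatched.lie (h : IsMatched ρ φ N u e) (h' : IsMatched ρ φ N v e') :
    IsMatched ρ φ N ⁅u, v⁆ ⁅e, e'⁆ where
  lie_apply y := by
    rw [lie_lie, lie_lie, h.lie_apply, h'.lie_apply, h.lie_apply, h'.lie_apply, map_sub]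
    rfl
  actsTrivially := by
    have h1 : UniversalEnvelopingAlgebra.lift F ρ ⁅u, v⁆ =
        ⁅UniversalEnvelopingAlgebra.lift F ρ u, UniversalEnvelopingAlgebra.lift F ρ v⁆ := by
      simp [LieRing.of_associative_ring_bracket]
    rw [h1, LieHom.map_lie]
    exact h.actsTrivially.lie h'.actsTrivially

theorem IsMatched.apply (hφ : φ.comp ι = universalPEnvelope.ι F p L) (hN : ∀ x, ι x ∈ N) (x : L) :
    IsMatched ρ φ N (UniversalEnvelopingAlgebra.ι F x) (ι x) := by
  have hx : (φ (ι x) : UniversalEnvelopingAlgebra F L) = UniversalEnvelopingAlgebra.ι F x :=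
    congrArg Subtype.val (LieHom.congr_fun hφ x)
  refine ⟨fun y => ?_, ?_⟩
  · rw [LieHom.map_lie, ← hx]
    rfl
  · rw [← hx]
    exact ActsTrivially.apply (((universalPEnvelope.lift F p ρ).comp φ).comp N.incl) ⟨ι x, hN x⟩

/-- This closure replaces the missing compatibility of `φ` with `p`-th powers: `u ^ p` is taken in
`U(L)`, and `φ (P e)` never appears. -/
theorem IsMatched.pow [Fact p.Prime] [CharP F p] (hP : IsPMapping F p P)
    (h : IsMatched ρ φ N u e) : IsMatched ρ φ N (u ^ p) (P e) where
  lie_apply y := by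
    have hk : ∀ k : ℕ, (LieAlgebra.ad F _ u ^ k) (φ y : UniversalEnvelopingAlgebra F L) =
        φ ((LieAlgebra.ad F E e ^ k) y) := by
      intro k
      induction k with
      | zero => rfl
      | succ k ih =>
        rw [pow_succ', pow_succ', Module.End.mul_apply, ih, Module.End.mul_apply,
          LieAlgebra.ad_apply, LieAlgebra.ad_apply, h.lie_apply]
    rw [hP.lie_map, ← hk, ← LieAlgebra.ad_pow_prime, LieAlgebra.ad_apply]
  actsTrivially := by
    have h1 : LieModule.toEnd F E N (P e) = LieModule.toEnd F E N e ^ p := by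
      ext x
      rw [LieSubmodule.coe_toEnd_pow, LieSubmodule.coe_toEnd]
      exact hP.lie_map e x
    rw [map_pow, h1]
    exact h.actsTrivially.pow_prime p

variable [Fact p.Prime] [CharP F p]

/-- The elements of `E` with a partner in `L̂` form a Lie subalgebra that contains `ι(L)` and is
closed under `P`, hence all of `E`. -/
theorem exists_isMatched_left (hE : IsPEnvelope F p P ι)
    (hφ : φ.comp ι = universalPEnvelope.ι F p L) (hN : ∀ x, ι x ∈ N) (e : E) :
    ∃ u ∈ universalPEnvelope F p L, IsMatched ρ φ N u e := by
  let H : LieSubalgebra F E :=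
    { carrier := {e | ∃ u ∈ universalPEnvelope F p L, IsMatched ρ φ N u e}
      zero_mem' := ⟨0, zero_mem _, .zero⟩
      add_mem' := fun ⟨u, hu, h⟩ ⟨v, hv, h'⟩ => ⟨u + v, add_mem hu hv, h.add h'⟩
      smul_mem' := fun c _ ⟨u, hu, h⟩ =>
        ⟨c • u, (universalPEnvelope F p L).smul_mem c hu, h.smul c⟩
      lie_mem' := fun ⟨u, hu, h⟩ ⟨v, hv, h'⟩ =>
        ⟨⁅u, v⁆, (universalPEnvelope F p L).lie_mem hu hv, h.lie h'⟩ }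
  exact hE.mem_of_forall H (fun x => ⟨_, (universalPEnvelope.ι F p L x).2, .apply hφ hN x⟩)
    (fun a ⟨u, hu, h⟩ => ⟨u ^ p, universalPEnvelope.pow_mem F p ⟨u, hu⟩, h.pow hE.isPMapping⟩) e

theorem exists_isMatched_right (hE : IsPEnvelope F p P ι)
    (hφ : φ.comp ι = universalPEnvelope.ι F p L) (hN : ∀ x, ι x ∈ N)
    (hu : u ∈ universalPEnvelope F p L) : ∃ e, IsMatched ρ φ N u e := by
  let H : LieSubalgebra F (UniversalEnvelopingAlgebra F L) :=
    { carrier := {u | ∃ e, IsMatched ρ φ N u e}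
      zero_mem' := ⟨0, .zero⟩
      add_mem' := fun ⟨e, h⟩ ⟨e', h'⟩ => ⟨e + e', h.add h'⟩
      smul_mem' := fun c _ ⟨e, h⟩ => ⟨c • e, h.smul c⟩
      lie_mem' := fun ⟨e, h⟩ ⟨e', h'⟩ => ⟨⁅e, e'⁆, h.lie h'⟩ }
  refine (mem_pClosure F _ _ _).mp hu H ?_ fun a ⟨e, h⟩ => ⟨P e, h.pow hE.isPMapping⟩
  rintro _ ⟨x, rfl⟩
  exact ⟨ι x, .apply hφ hN x⟩

/-- Every element of a `p`-envelope acts nilpotently on the cohomology of an ideal that contains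
the image of `L`. -/
theorem IsPEnvelope.exists_pow_mem_coboundaries (hE : IsPEnvelope F p P ι)
    (hφ : φ.comp ι = universalPEnvelope.ι F p L) (hN : ∀ x, ι x ∈ N) (e : E)
    (hc : IsCompatible (((universalPEnvelope.lift F p ρ).comp φ).comp N.incl)
      ((universalPEnvelope.lift F p ρ).comp φ e) (LieModule.toEnd F E N e)) {n : ℕ}
    {f : N [⋀^Fin n]→ₗ[F] M}
    (hf : f ∈ cocycles (((universalPEnvelope.lift F p ρ).comp φ).comp N.incl) n) :
    (cochainAct ((universalPEnvelope.lift F p ρ).comp φ e) (LieModule.toEnd F E N e) n ^ p) f ∈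
      coboundaries (((universalPEnvelope.lift F p ρ).comp φ).comp N.incl) n := by
  obtain ⟨u, hu, h⟩ := exists_isMatched_left (ρ := ρ) hE hφ hN e
  -- `e'` corrects the discrepancy between `φ e` and the partner `u` of `e`: the sum of the two
  -- matched pairs is `(φ e, e + e')`.
  obtain ⟨e', h'⟩ := exists_isMatched_right (ρ := ρ) hE hφ hN (sub_mem (φ e).2 hu)
  -- Both `φ e` and `u` have bracket `φ [e, y]` with `φ y`, so their difference commutes with `φ y`.
  have hzero : ∀ y, φ ⁅e', y⁆ = 0 := by
    intro y
    have h1 := h'.lie_apply y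
    rw [sub_lie, h.lie_apply, LieHom.map_lie] at h1
    refine Subtype.ext (h1.symm.trans ?_)
    exact sub_self _
  -- `[e', y]` is some `ι x`, and `φ (ι x) = 0` makes `x` vanish in `U(L)`; so `x` is central in `L`
  -- and `ι x` commutes with `E`.
  have hsq : ∀ y : E, ⁅e', ⁅e', y⁆⁆ = 0 := by
    intro y
    obtain ⟨x, hx⟩ := hE.lie_mem_range e' y
    change ι x = _ at hx
    rw [← hx]
    refine hE.lie_apply_eq_zero (lie_eq_zero_of_ι_eq_zero (F := F) ?_) e'
    have h1 := congrArg Subtype.val (LieHom.congr_fun hφ x)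
    rw [LieHom.comp_apply, hx, hzero] at h1
    exact h1.symm
  have hD : LieModule.toEnd F E N e' ^ p = 0 := by
    have h2 : LieModule.toEnd F E N e' ^ 2 = 0 := by
      ext x
      rw [LieSubmodule.coe_toEnd_pow, pow_two, Module.End.mul_apply]
      exact hsq x
    exact pow_eq_zero_of_le (Fact.out : p.Prime).two_le h2
  refine hc.exists_pow_mem_coboundaries p ?_ hD hf
  have h3 := (h.add h').actsTrivially
  rw [add_sub_cancel, map_add (LieModule.toEnd F E N)] at h3
  exact h3

/-- Adjoining an element of the `p`-envelope to an ideal that contains the image of `L` does not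
change the vanishing of the cohomology up to degree `n`. -/
theorem IsPEnvelope.cocycles_le_coboundaries_iff (hE : IsPEnvelope F p P ι)
    (hφ : φ.comp ι = universalPEnvelope.ι F p L) (hN : ∀ x, ι x ∈ N) {N' : LieIdeal F E}
    (he : e ∉ N) (hN' : (N' : Submodule F E) = (N : Submodule F E) ⊔ Submodule.span F {e}) (n : ℕ) :
    (∀ k ≤ n, cocycles (((universalPEnvelope.lift F p ρ).comp φ).comp N.incl) k ≤
        coboundaries (((universalPEnvelope.lift F p ρ).comp φ).comp N.incl) k) ↔
      ∀ k ≤ n, cocycles (((universalPEnvelope.lift F p ρ).comp φ).comp N'.incl) k ≤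
        coboundaries (((universalPEnvelope.lift F p ρ).comp φ).comp N'.incl) k := by
  set τ := (universalPEnvelope.lift F p ρ).comp φ with hτ
  have hle : N ≤ N' := by
    intro x hx
    have h1 : x ∈ (N' : Submodule F E) := hN' ▸ Submodule.mem_sup_left hx
    exact h1
  have heN' : e ∈ N' := by
    have h1 : e ∈ (N' : Submodule F E) :=
      hN' ▸ Submodule.mem_sup_right (Submodule.mem_span_singleton_self e)
    exact h1
  obtain ⟨l₀, hl₀, hker⟩ := Submodule.exists_le_ker_of_notMem (p := (N : Submodule F E)) he
  -- A functional that vanishes on `N` and equals `1` at `e`; it gives the projection `x ↦ x - l x •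
  -- e` of `N'` onto `N`.
  let l : E →ₗ[F] F := (l₀ e)⁻¹ • l₀
  have hle1 : l e = 1 := by simp [l, hl₀]
  have hlN : ∀ x ∈ N, l x = 0 := by
    intro x hx
    have h1 : l₀ x = 0 := hker hx
    simp [l, h1]
  have hproj : ∀ x ∈ N', x - l x • e ∈ N := by
    intro x hx
    have h1 : x ∈ (N' : Submodule F E) := hx
    rw [hN', Submodule.mem_sup] at h1
    obtain ⟨y, hy, z, hz, rfl⟩ := h1
    obtain ⟨c, rfl⟩ := Submodule.mem_span_singleton.mp hz
    rw [map_add, map_smul, hlN y hy, hle1]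
    simpa using hy
  let j : N →ₗ⁅F⁆ N' := LieIdeal.inclusion hle
  let π : N' →ₗ[F] N :=
    { toFun := fun x => ⟨x - l x • e, hproj x x.2⟩
      map_add' := fun x y => by
        ext
        simp [add_smul, add_sub_add_comm]
      map_smul' := fun c x => by
        ext
        simp [smul_sub, smul_smul] }
  have hdec : IsComplementVector (j : N →ₗ[F] N') π (l ∘ₗ (N' : Submodule F E).subtype)
      ⟨e, heN'⟩ :=
    { proj_apply := fun x => Subtype.ext (by
        change (x : E) - l x • e = x
        rw [hlN x x.2, zero_smul, sub_zero])
      coord_apply := fun x => hlN x x.2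
      coord_vector := hle1
      decomp := fun g => Subtype.ext (by
        change (g : E) = ((g : E) - l g • e) + l g • e
        rw [sub_add_cancel]) }
  have hD : ∀ x, j (LieModule.toEnd F E N e x) = ⁅(⟨e, heN'⟩ : N'), j x⁆ := fun x => rfl
  have hc : IsCompatible ((τ.comp N'.incl).comp j) (τ.comp N'.incl ⟨e, heN'⟩)
      (LieModule.toEnd F E N e) :=
    { lie_apply := fun x => (τ.map_lie e x).symm
      lie_ad := fun x => by
        ext y
        change ⁅e, ⁅(x : E), (y : E)⁆⁆ - ⁅(x : E), ⁅e, (y : E)⁆⁆ = ⁅⁅e, (x : E)⁆, (y : E)⁆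
        rw [lie_lie] }
  constructor
  · intro h k hk
    exact hdec.cocycles_le_coboundaries (τ.comp N'.incl) hD hc fun i hi => h i (hi.trans hk)
  · intro h k hk
    exact hdec.cocycles_comp_le_coboundaries (τ.comp N'.incl) hD hc
      (fun f hf => ⟨p, hE.exists_pow_mem_coboundaries hφ hN e hc hf⟩) (h k hk)

/-! ### From the image of `L` up to the whole envelope -/

theorem IsPEnvelope.cocycles_le_coboundaries_iff_top [Module.Finite F E]
    (hE : IsPEnvelope F p P ι) (hφ : φ.comp ι = universalPEnvelope.ι F p L) (n : ℕ)
    (N : LieIdeal F E) (hN : ∀ x, ι x ∈ N) :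
    (∀ k ≤ n, cocycles (((universalPEnvelope.lift F p ρ).comp φ).comp N.incl) k ≤
        coboundaries (((universalPEnvelope.lift F p ρ).comp φ).comp N.incl) k) ↔
      ∀ k ≤ n, cocycles (((universalPEnvelope.lift F p ρ).comp φ).comp
          (⊤ : LieIdeal F E).incl) k ≤
        coboundaries (((universalPEnvelope.lift F p ρ).comp φ).comp (⊤ : LieIdeal F E).incl) k := by
  -- Ideals of the finite-dimensional `E` satisfy the ascending chain condition, so the claim may be
  -- assumed for all strictly larger ideals.
  induction N using WellFoundedGT.induction with
  | ind N ih =>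
    by_cases htop : N = ⊤
    · rw [htop]
    · obtain ⟨e, he⟩ : ∃ e, e ∉ N := by
        by_contra! h
        exact htop (eq_top_iff.mpr fun x _ => h x)
      let N' : LieIdeal F E :=
        { (N : Submodule F E) ⊔ Submodule.span F {e} with
          lie_mem := fun {a b} _ => by
            obtain ⟨x, hx⟩ := hE.lie_mem_range a b
            -- All brackets of `E` lie in `ι(L) ⊆ N`, so the enlarged subspace is again an ideal.
            exact Submodule.mem_sup_left (hx ▸ hN x) }
      have hlt : N < N' := by
        refine lt_of_le_of_ne (fun x hx => Submodule.mem_sup_left hx) fun h => he ?_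
        rw [h]
        exact Submodule.mem_sup_right (Submodule.mem_span_singleton_self e)
      rw [hE.cocycles_le_coboundaries_iff hφ hN he (N' := N') rfl n]
      exact ih N' hlt fun x => hlt.le (hN x)

theorem IsPEnvelope.subsingleton_H_iff [Module.Finite F E] (hE : IsPEnvelope F p P ι)
    (hφ : φ.comp ι = universalPEnvelope.ι F p L) (n : ℕ) :
    (∀ k ≤ n, Subsingleton (H ρ k)) ↔
      ∀ k ≤ n, Subsingleton (H ((universalPEnvelope.lift F p ρ).comp φ) k) := by
  let N : LieIdeal F E :=
    { ι.range.toSubmodule with lie_mem := fun {a b} _ => hE.lie_mem_range a b }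
  let ι' : L →ₗ⁅F⁆ N :=
    { toFun := fun x => ⟨ι x, x, rfl⟩
      map_add' := fun x y => Subtype.ext (map_add ι x y)
      map_smul' := fun c x => Subtype.ext (map_smul ι c x)
      map_lie' := fun {x y} => Subtype.ext (ι.map_lie x y) }
  have hι' : Function.Bijective ι' :=
    ⟨fun x y h => hE.injective (congrArg Subtype.val h),
      fun ⟨_, x, hx⟩ => ⟨x, Subtype.ext hx⟩⟩
  have h1 : ∀ k, Subsingleton (H ρ k) ↔
      Subsingleton (H (((universalPEnvelope.lift F p ρ).comp φ).comp N.incl) k) := by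
    refine subsingleton_H_iff_of_equiv (LieEquiv.ofBijective ι' hι') fun x => ?_
    change universalPEnvelope.lift F p ρ (φ.comp ι x) = ρ x
    rw [hφ]
    exact LieHom.congr_fun (universalPEnvelope.lift_comp_ι F p ρ) x
  have h2 : ∀ k, Subsingleton (H (((universalPEnvelope.lift F p ρ).comp φ).comp
      (⊤ : LieIdeal F E).incl) k) ↔
      Subsingleton (H ((universalPEnvelope.lift F p ρ).comp φ) k) :=
    subsingleton_H_iff_of_equiv LieIdeal.topEquiv fun x => rfl
  simp only [h1, ← h2, LieCohomology.subsingleton_H_iff]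
  exact hE.cocycles_le_coboundaries_iff_top hφ n N fun x => ⟨x, rfl⟩

end Matched

end RestrictedLie

theorem mainTheorem2 {F : Type*} [Field F] {p : ℕ} [Fact p.Prime] [CharP F p]
    {L : Type*} [LieRing L] [LieAlgebra F L] [Module.Finite F L]
    {M : Type*} [AddCommGroup M] [Module F M] [LieRingModule L M] [LieModule F L M]
    [Module.Finite F M]
    {E : Type*} [LieRing E] [LieAlgebra F E] (P : E → E) (ι : L →ₗ⁅F⁆ E)
    (hE : RestrictedLie.IsPEnvelope F p P ι)
    (hfin : Module.Finite F (E ⧸ ι.range.toSubmodule))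
    (φ : E →ₗ⁅F⁆ RestrictedLie.universalPEnvelope F p L)
    (hφ : φ.comp ι = RestrictedLie.universalPEnvelope.ι F p L) :
    (∀ n : ℕ,
      (∀ j ≤ n, Subsingleton (LieCohomology.H (LieModule.toEnd F L M) j)) ↔
        ∀ j ≤ n, Subsingleton (LieCohomology.H
          ((RestrictedLie.universalPEnvelope.lift F p (LieModule.toEnd F L M)).comp φ) j)) ∧
    ((∀ j : ℕ, Subsingleton (LieCohomology.H (LieModule.toEnd F L M) j)) ↔
      ∀ j : ℕ, Subsingleton (LieCohomology.H
        ((RestrictedLie.universalPEnvelope.lift F p (LieModule.toEnd F L M)).comp φ) j)) := by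
  have : Module.Finite F ι.range.toSubmodule := Module.Finite.range (ι : L →ₗ[F] E)
  have : Module.Finite F E := Module.Finite.of_submodule_quotient ι.range.toSubmodule
  have h := hE.subsingleton_H_iff (ρ := LieModule.toEnd F L M) hφ
  refine ⟨h, fun hL j => (h j).mp (fun k _ => hL k) j le_rfl,
    fun hL j => (h j).mpr (fun k _ => hL k) j le_rfl⟩
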